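/- Let $D$ be an oriented virtual link diagram: a finite plane 4-valent graph, possibly together with finitely many crossing-free circles, whose edges are oriented so that opposite edge-ends at a vertex are consecutive on a strand, and whose vertices are marked as classical (positive or negative) or virtual crossings. A short arc of $D$ is an edge or a crossing-free circle; a long arc is a maximal arc that passes through no classical crossing (it may pass through virtual ones, and may be closed). Put $A=\mathbb{Z}[t,t^{-1},s,s^{-1}]$, and draw every crossing with both strands directed upwards, so that each strand has one end to the left and one end to the right of the crossing. Let $ABQ(D)$ be the $A$-module generated by the long arcs, with, for every classical crossing, the relations $$u_R=s^{-1}t\,u_L+s^{-1}(1-t)\,o_L,\qquad o_R=s^{-1}o_L,$$ where $u_L,u_R$ (respectively $o_L,o_R$) are the arcs to the left and to the right of the crossing on the under-strand (respectively the over-strand). Let $VAQ(D)$ be the $A$-module generated by the short arcs, with, for every classical crossing, the relations $$u_R=t\,u_L+(1-t)\,o_L,\qquad o_R=o_L,$$ and, for each of the two strands at every virtual crossing, the relation $r=s\,l$, where $l$ and $r$ are the arcs of that strand to the left and to the right of the crossing. Then $ABQ(D)$ and $VAQ(D)$ are isomorphic as $A$-modules. Their (zeroth) Fitting ideals are principal,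 and if $G_D(s,t)$ (the generalized Alexander polynomial) is any generator of the Fitting ideal of $ABQ(D)$ and $\xi(D)$ is any generator of the Fitting ideal of $VAQ(D)$, then $G_D(s,t)=\pm t^k s^l\,\xi(D)$ for some sign and some $k,l\in\mathbb{Z}$. -/

import Mathlib

/-! ### Oriented virtual link diagrams

A diagram is encoded as an oriented plane 4-valent graph, i.e. as a combinatorial map of genus
zero.  Every crossing is drawn with both strands going upwards, so that it has two incoming
half-edges at the bottom and two outgoing half-edges at the top, one on the left and one on the
right.  One strand runs from bottom left to top right, the other from bottom right to top left. -/

/-- The left or the right side of a crossing (seen with both strands going upwards). -/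
inductive Side where
  | left
  | right

/-- The type of a crossing.  At a positive crossing the strand from bottom left to top right passes
over, at a negative crossing it passes under. -/
inductive CrossingKind where
  | positive
  | negative
  | virtual

/-- The combinatorial data of an oriented diagram with set of crossings `X`: the types of the
crossings, the bijection `next` which sends each outgoing half-edge (a crossing and the side on
which the half-edge leaves it at the top) to the incoming half-edge at which the edge starting there
ends (a crossing and the side on which it is entered at the bottom), and the number of
components without any crossing. -/
structure DiagramCode (X : Type*) where
  kind : X → CrossingKind
  next : X × Side ≃ X × Side
  circles : ℕ

namespace DiagramCode

variable {X : Type*} (D : DiagramCode X)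

/-- Half-edges: `Sum.inl` are the outgoing (top) ones, `Sum.inr` the incoming (bottom) ones. -/
abbrev HalfEdge (X : Type*) := (X × Side) ⊕ (X × Side)

/-- The next half-edge at the same crossing in the counterclockwise direction: bottom left, bottom
right, top right, top left. -/
def rotate : HalfEdge X → HalfEdge X
  | Sum.inr (c, Side.left) => Sum.inr (c, Side.right)
  | Sum.inr (c, Side.right) => Sum.inl (c, Side.right)
  | Sum.inl (c, Side.right) => Sum.inl (c, Side.left)
  | Sum.inl (c, Side.left) => Sum.inr (c, Side.left)

/-- The other half of the same edge. -/
def opposite : HalfEdge X → HalfEdge X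
  | Sum.inl h => Sum.inr (D.next h)
  | Sum.inr h => Sum.inl (D.next.symm h)

/-- The faces of the combinatorial map: the orbits of `rotate ∘ opposite` on half-edges. -/
def Face : Type _ :=
  Quotient (Relation.EqvGen.setoid
    (fun h k : HalfEdge X => k = rotate (D.opposite h)))

/-- The connected components of the 4-valent graph. -/
def GraphComponent : Type _ :=
  Quotient (Relation.EqvGen.setoid
    (fun c d : X => ∃ i : Side, d = (D.next (c, i)).1))

/-- Euler's formula: every component of the graph lies on a sphere. -/
def IsPlanar : Prop :=
  (Nat.card X : ℤ) - Nat.card (X × Side) + Nat.card D.Face = 2 * Nat.card D.GraphComponent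

end DiagramCode

/-- An oriented virtual link diagram with set of crossings `X`. -/
structure VirtualLinkDiagram (X : Type*) extends DiagramCode X where
  planar : toDiagramCode.IsPlanar

namespace VirtualLinkDiagram

variable {X : Type*} (D : VirtualLinkDiagram X)

/-- Short arcs: the edges of the graph (each given by the outgoing half-edge at which it starts)
and the components without crossings. -/
abbrev ShortArc : Type _ := (X × Side) ⊕ Fin D.circles

/-- The short arc which leaves the crossing `c` at the top on the given side. -/
def outArc (c : X) (i : Side) : D.ShortArc := Sum.inl (c, i)

/-- The short arc which enters the crossing `c` at the bottom on the given side. -/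
def inArc (c : X) (i : Side) : D.ShortArc := Sum.inl (D.next.symm (c, i))

/-- Two short arcs are successive if one continues the other through a virtual crossing. -/
inductive VirtualStep : D.ShortArc → D.ShortArc → Prop
  | leftToRight (c : X) (hc : D.kind c = CrossingKind.virtual) :
      VirtualStep (D.inArc c Side.left) (D.outArc c Side.right)
  | rightToLeft (c : X) (hc : D.kind c = CrossingKind.virtual) :
      VirtualStep (D.inArc c Side.right) (D.outArc c Side.left)

/-- Long arcs: maximal arcs which contain no classical crossing in their interior. -/
def LongArc : Type _ := Quotient (Relation.EqvGen.setoid D.VirtualStep)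

/-- The long arc that contains a short arc. -/
def toLong (a : D.ShortArc) : D.LongArc := Quotient.mk _ a

/-- `D.IsClassicalCrossing uL uR oL oR` : at some classical crossing, the short arcs to the
left and to the right of the crossing on the under-strand are `uL` and `uR`, and those on the
over-strand are `oL` and `oR`. -/
inductive IsClassicalCrossing : D.ShortArc → D.ShortArc → D.ShortArc → D.ShortArc → Prop
  | positive (c : X) (hc : D.kind c = CrossingKind.positive) :
      IsClassicalCrossing (D.outArc c Side.left) (D.inArc c Side.right)
        (D.inArc c Side.left) (D.outArc c Side.right)
  | negative (c : X) (hc : D.kind c = CrossingKind.negative) :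
      IsClassicalCrossing (D.inArc c Side.left) (D.outArc c Side.right)
        (D.outArc c Side.left) (D.inArc c Side.right)

/-- `D.IsVirtualStrand l r` : `l` and `r` are the short arcs to the left and to the right of a
virtual crossing on one of the two strands through it. -/
inductive IsVirtualStrand : D.ShortArc → D.ShortArc → Prop
  | leftToRight (c : X) (hc : D.kind c = CrossingKind.virtual) :
      IsVirtualStrand (D.inArc c Side.left) (D.outArc c Side.right)
  | rightToLeft (c : X) (hc : D.kind c = CrossingKind.virtual) :
      IsVirtualStrand (D.outArc c Side.left) (D.inArc c Side.right)

end VirtualLinkDiagram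

/-! ### The Alexander modules -/

/-- The ring `ℤ[t, t⁻¹, s, s⁻¹]`; the exponent `(k, l)` belongs to the monomial `t ^ k * s ^ l`. -/
abbrev LaurentTS : Type := AddMonoidAlgebra ℤ (ℤ × ℤ)

/-- The monomial `t ^ k * s ^ l`. -/
noncomputable def monoTS (k l : ℤ) : LaurentTS := AddMonoidAlgebra.single (k, l) 1

namespace VirtualLinkDiagram

variable {X : Type*} (D : VirtualLinkDiagram X)

/-- The free module on the long arcs. -/
abbrev LongFree : Type _ := D.LongArc →₀ LaurentTS

/-- The free module on the short arcs. -/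
abbrev ShortFree : Type _ := D.ShortArc →₀ LaurentTS

/-- The generator of the free module which belongs to the long arc through a short arc. -/
noncomputable def longGen (a : D.ShortArc) : D.LongFree := Finsupp.single (D.toLong a) 1

/-- The generator of the free module which belongs to a short arc. -/
noncomputable def shortGen (a : D.ShortArc) : D.ShortFree := Finsupp.single a 1

/-- The relations `uR = uL ∘ oL` and `oR = oL ∗ uL` at the classical crossings, where
`x ∘ y = s⁻¹ t x + s⁻¹ (1 - t) y` and `x ∗ y = s⁻¹ x`. -/
inductive ABQRel : D.LongFree → Prop
  | under (uL uR oL oR : D.ShortArc) (h : D.IsClassicalCrossing uL uR oL oR) :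
      ABQRel (D.longGen uR - ((monoTS 0 (-1) * monoTS 1 0) • D.longGen uL +
        (monoTS 0 (-1) * (1 - monoTS 1 0)) • D.longGen oL))
  | over (uL uR oL oR : D.ShortArc) (h : D.IsClassicalCrossing uL uR oL oR) :
      ABQRel (D.longGen oR - monoTS 0 (-1) • D.longGen oL)

/-- The Alexander biquandle module. -/
abbrev ABQ : Type _ := D.LongFree ⧸ Submodule.span LaurentTS {r | D.ABQRel r}

/-- The relations `uR = uL ∘ oL` and `oR = oL ∗ uL` at the classical crossings, where
`x ∘ y = t x + (1 - t) y` and `x ∗ y = x`, and the relations `r = f l` at the virtual crossings,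
where `f x = s x`. -/
inductive VAQRel : D.ShortFree → Prop
  | under (uL uR oL oR : D.ShortArc) (h : D.IsClassicalCrossing uL uR oL oR) :
      VAQRel (D.shortGen uR - (monoTS 1 0 • D.shortGen uL +
        (1 - monoTS 1 0) • D.shortGen oL))
  | over (uL uR oL oR : D.ShortArc) (h : D.IsClassicalCrossing uL uR oL oR) :
      VAQRel (D.shortGen oR - D.shortGen oL)
  | virtual (l r : D.ShortArc) (h : D.IsVirtualStrand l r) :
      VAQRel (D.shortGen r - monoTS 0 1 • D.shortGen l)

/-- The virtual Alexander quandle module. -/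
abbrev VAQ : Type _ := D.ShortFree ⧸ Submodule.span LaurentTS {r | D.VAQRel r}

end VirtualLinkDiagram

/-! ### Fitting ideals and the polynomial invariants -/

/-- The (zeroth) Fitting ideal of a finitely generated module `M`: it is generated by the
determinants of the square matrices `R` of size `n` whose rows are relations between `n` generators
of `M`.  (Each generating family alone gives the same ideal.) -/
def fittingIdeal (A : Type*) [CommRing A] (M : Type*) [AddCommGroup M] [Module A M] : Ideal A :=
  Ideal.span {d | ∃ (n : ℕ) (x : Fin n → M) (R : Matrix (Fin n) (Fin n) A),
    Submodule.span A (Set.range x) = ⊤ ∧ (∀ i, ∑ j, R i j • x j = 0) ∧ d = R.det}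

namespace VirtualLinkDiagram

variable {X : Type*} (D : VirtualLinkDiagram X)

/-- `G` is a generalized Alexander polynomial `G_D(s,t)` of the diagram: a generator of the Fitting
ideal of `ABQ(D)`. -/
def IsGeneralizedAlexanderPolynomial (G : LaurentTS) : Prop :=
  fittingIdeal LaurentTS D.ABQ = Ideal.span {G}

/-- `P` is a polynomial `ξ(D)` of the diagram: a generator of the Fitting ideal of `VAQ(D)`. -/
def IsXiPolynomial (P : LaurentTS) : Prop :=
  fittingIdeal LaurentTS D.VAQ = Ideal.span {P}

end VirtualLinkDiagram

open Relation Matrix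

/-! The isomorphism is a rescaling of generators by an Alexander numbering. Let `n` be an integer
labelling of the short arcs that increases by one from the left to the right of every crossing. Then
`a ↦ s ^ n a • a` turns the relations of `VAQ` into those of `ABQ`: at a classical crossing the jump
of `n` supplies the factor `s⁻¹`, and at a virtual crossing it absorbs the factor `s`, so that the
two arcs of the strand may be identified.

Such an `n` exists by planarity. The constant 1 on edges is a circulation, since two edges enter and
two leave each crossing; Euler's formula makes every circulation a difference of face values
(`range_faceDifference`).

For the Fitting ideals, `VAQ` has as many relations as generators, so its ideal is generated by one
determinant (`fittingIdeal_quotient_span_range`). The isomorphism carries this over to `ABQ`. Two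
generators of a principal ideal in the domain `LaurentTS` differ by a unit, and the units are the
signed monomials. -/

/-! ### Fitting ideals and square presentations -/

theorem fittingIdeal_le_of_linearEquiv {A : Type*} [CommRing A] {M N : Type*} [AddCommGroup M]
    [Module A M] [AddCommGroup N] [Module A N] (e : M ≃ₗ[A] N) :
    fittingIdeal A M ≤ fittingIdeal A N := by
  refine Ideal.span_mono ?_
  rintro d ⟨n, x, R, hx, hR, hd⟩
  refine ⟨n, fun i => e (x i), R, ?_, fun i => ?_, hd⟩
  · have : Set.range (fun i => e (x i)) = (e : M →ₗ[A] N) '' Set.range x := by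
      rw [← Set.range_comp]; rfl
    rw [this, Submodule.span_image, hx, Submodule.map_top, LinearEquiv.range]
  · simpa [map_sum] using congrArg e (hR i)

theorem fittingIdeal_congr {A : Type*} [CommRing A] {M N : Type*} [AddCommGroup M]
    [Module A M] [AddCommGroup N] [Module A N] (e : M ≃ₗ[A] N) :
    fittingIdeal A M = fittingIdeal A N :=
  le_antisymm (fittingIdeal_le_of_linearEquiv e) (fittingIdeal_le_of_linearEquiv e.symm)

/-- The determinant of a square presentation matrix divides every determinant of a square matrix of
relations between generators of the same module. -/
theorem det_dvd_det_of_relations {A : Type*} [CommRing A] {M : Type*} [AddCommGroup M] [Module A M]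
    {ι κ : Type*} [Fintype ι] [DecidableEq ι] [Fintype κ] [DecidableEq κ]
    (x : ι → M) (P : Matrix ι ι A) (hx : Submodule.span A (Set.range x) = ⊤)
    (hP : ∀ v : ι → A, ∑ i, v i • x i = 0 → ∃ w : ι → A, v = w ᵥ* P)
    (y : κ → M) (R : Matrix κ κ A) (hy : Submodule.span A (Set.range y) = ⊤)
    (hR : ∀ i, ∑ j, R i j • y j = 0) : P.det ∣ R.det := by
  have hB : ∀ j, ∃ b : ι → A, ∑ i, b i • x i = y j := fun j =>
    (Submodule.mem_span_range_iff_exists_fun A).1 (hx ▸ Submodule.mem_top)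
  have hC : ∀ i, ∃ c : κ → A, ∑ j, c j • y j = x i := fun i =>
    (Submodule.mem_span_range_iff_exists_fun A).1 (hy ▸ Submodule.mem_top)
  choose B hB using hB
  choose C hC using hC
  -- Replacing each `y j` by its expression in the `x i` turns a joint relation into one among the
  -- `x i`, hence into a combination of rows of `P`.
  have key : ∀ (a : ι → A) (b : κ → A), ∑ i, a i • x i + ∑ j, b j • y j = 0 →
      ∃ w : ι → A, a + b ᵥ* (of B) = w ᵥ* P := by
    intro a b hab
    apply hP
    rw [← hab]
    simp only [Pi.add_apply, add_smul, Finset.sum_add_distrib, vecMul, dotProduct, of_apply,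
      Finset.sum_smul, ← hB, Finset.smul_sum, smul_smul]
    rw [Finset.sum_comm]
  have h1 : ∀ i, ∃ w : ι → A, Pi.single i 1 + (-C i) ᵥ* (of B) = w ᵥ* P := by
    intro i
    apply key
    simp [Pi.single_apply, ite_smul, hC]
  have h2 : ∀ j, ∃ w : ι → A, 0 + R j ᵥ* (of B) = w ᵥ* P := by
    intro j
    apply key
    simp [hR]
  choose U hU using h1
  choose V hV using h2
  -- The rows on the left are relations of the joint family `(x, y)`; all of these are combinations
  -- of the rows `(P, 0)` and `(-B, 1)`. The determinants of the block triangular matrices are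
  -- `R.det` and `P.det`.
  have hfac : fromBlocks 1 (-of C) 0 R =
      fromBlocks (of U) (-of C) (of V) R * fromBlocks P 0 (-of B) 1 := by
    rw [fromBlocks_multiply]
    congr 1
    · rw [Matrix.neg_mul, Matrix.mul_neg, neg_neg]
      ext i k
      have := congrFun (hU i) k
      simp only [Pi.add_apply, neg_vecMul, Pi.neg_apply] at this
      simp only [Matrix.add_apply, one_apply, mul_apply]
      simp only [vecMul, dotProduct, of_apply] at this
      rw [Pi.single_apply] at this
      simp only [of_apply, ← this, eq_comm (a := k)]
      ring
    · simp
    · ext i k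
      have := congrFun (hV i) k
      simp only [vecMul, dotProduct, of_apply, Pi.add_apply, Pi.zero_apply, zero_add] at this
      simp [mul_apply, ← this]
    · simp
  have hdet := congrArg Matrix.det hfac
  rw [det_fromBlocks_zero₂₁, det_mul, det_fromBlocks_zero₁₂] at hdet
  simp only [det_one, one_mul, mul_one] at hdet
  exact ⟨_, by rw [hdet, mul_comm]⟩

/-- The determinant of the presentation divides every determinant in the definition, and after
numbering the generators it is one of them. -/
theorem fittingIdeal_quotient_span_range {A : Type*} [CommRing A] {ι : Type*} [Fintype ι]
    [DecidableEq ι] (r : ι → ι →₀ A) :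
    fittingIdeal A ((ι →₀ A) ⧸ Submodule.span A (Set.range r)) =
      Ideal.span {(of fun i j => r i j).det} := by
  set q := (Submodule.span A (Set.range r)).mkQ with hq
  have hsum : ∀ v : ι →₀ A, ∑ i, v i • q (Finsupp.single i 1) = q v := by
    intro v
    conv_rhs => rw [← Finsupp.sum_single v]
    rw [Finsupp.sum_fintype _ _ (by simp), map_sum]
    refine Finset.sum_congr rfl fun i _ => ?_
    rw [← map_smul, Finsupp.smul_single, smul_eq_mul, mul_one]
  have hspan : Submodule.span A (Set.range fun i : ι => q (Finsupp.single i 1)) = ⊤ := by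
    refine Submodule.eq_top_iff'.2 fun m => ?_
    obtain ⟨v, rfl⟩ := Submodule.mkQ_surjective _ m
    exact (Submodule.mem_span_range_iff_exists_fun A).2 ⟨v, hsum v⟩
  apply le_antisymm
  · rw [fittingIdeal, Ideal.span_le]
    rintro d ⟨n, y, R, hy, hR, rfl⟩
    refine Ideal.mem_span_singleton.2 (det_dvd_det_of_relations
      (fun i : ι => q (Finsupp.single i 1)) _ hspan (fun v hv => ?_) y R hy hR)
    have h0 := hsum (Finsupp.equivFunOnFinite.symm v)
    simp only [Finsupp.equivFunOnFinite_symm_apply_apply] at h0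
    rw [hv, hq, Submodule.mkQ_apply, eq_comm, Submodule.Quotient.mk_eq_zero,
      Submodule.mem_span_range_iff_exists_fun] at h0
    obtain ⟨w, hw⟩ := h0
    refine ⟨w, funext fun k => ?_⟩
    have := congrArg (fun f => f k) hw
    simpa [vecMul, dotProduct, Finsupp.finsetSum_apply] using this.symm
  · rw [Ideal.span_singleton_le_iff_mem]
    let e := Fintype.equivFin ι
    refine Ideal.subset_span ⟨Fintype.card ι, fun j => q (Finsupp.single (e.symm j) 1),
      reindex e e (of fun i j => r i j), ?_, fun i => ?_, ?_⟩
    · rw [← hspan]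
      congr 1
      exact e.symm.surjective.range_comp fun i : ι => q (Finsupp.single i 1)
    · simp only [reindex_apply, submatrix_apply, of_apply]
      rw [e.symm.sum_comp (fun j => r (e.symm i) j • q (Finsupp.single j 1)), hsum, hq,
        Submodule.mkQ_apply, Submodule.Quotient.mk_eq_zero]
      exact Submodule.subset_span ⟨_, rfl⟩
    · rw [det_reindex_self]

/-! ### Units of the Laurent polynomial ring -/

/-- The units of an integral group ring of a group with the two unique sums property are, up to
sign, the monomials. -/
theorem AddMonoidAlgebra.exists_eq_single_of_isUnit {G : Type*} [AddGroup G] [TwoUniqueSums G]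
    {u : AddMonoidAlgebra ℤ G} (hu : IsUnit u) :
    ∃ (g : G) (e : ℤˣ), u = AddMonoidAlgebra.single g (e : ℤ) := by
  classical
  obtain ⟨v, huv⟩ := hu.exists_right_inv
  -- At a uniquely attained sum the coefficient of `u * v = 1` is a single nonzero product, so that
  -- sum is the exponent 0.
  have hsupp : ∀ a ∈ u.coeff.support, ∀ b ∈ v.coeff.support,
      UniqueAdd u.coeff.support v.coeff.support a b → a + b = 0 := by
    intro a ha b hb h
    by_contra hab
    have h1 := AddMonoidAlgebra.coeff_mul_add_of_uniqueAdd h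
    rw [huv, AddMonoidAlgebra.one_def, AddMonoidAlgebra.coeff_single,
      Finsupp.single_eq_of_ne hab] at h1
    exact mul_ne_zero (Finsupp.mem_support_iff.1 ha) (Finsupp.mem_support_iff.1 hb) h1.symm
  -- Otherwise there would be two distinct pairs with unique sums; both sums are 0, which
  -- contradicts uniqueness.
  have hcard : u.coeff.support.card * v.coeff.support.card ≤ 1 := by
    by_contra! hlt
    obtain ⟨p, hp, q, hq, hpq, hup, huq⟩ := TwoUniqueSums.uniqueAdd_of_one_lt_card hlt
    rw [Finset.mem_product] at hp hq
    have h := hsupp _ hp.1 _ hp.2 hup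
    have h' := huq hp.1 hp.2 (h.trans (hsupp _ hq.1 _ hq.2 huq).symm)
    exact hpq (Prod.ext h'.1 h'.2)
  have hu0 : u.coeff.support.card ≠ 0 := by
    intro h
    have : u = 0 := by simpa using h
    simp [this] at huv
  have hv0 : v.coeff.support.card ≠ 0 := by
    intro h
    have : v = 0 := by simpa using h
    simp [this] at huv
  have hu1 : u.coeff.support.card = 1 := by
    nlinarith [Nat.pos_of_ne_zero hu0, Nat.pos_of_ne_zero hv0]
  have hv1 : v.coeff.support.card = 1 := by
    nlinarith [Nat.pos_of_ne_zero hu0, Nat.pos_of_ne_zero hv0]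
  obtain ⟨g, hg, hug⟩ := Finsupp.card_support_eq_one.1 hu1
  obtain ⟨k, hk, hvk⟩ := Finsupp.card_support_eq_one.1 hv1
  have hue : u = AddMonoidAlgebra.single g (u.coeff g) := by
    apply AddMonoidAlgebra.coeff_injective; exact hug
  have hve : v = AddMonoidAlgebra.single k (v.coeff k) := by
    apply AddMonoidAlgebra.coeff_injective; exact hvk
  have hgk : u.coeff g * v.coeff k = 1 := by
    have h0 : g + k = 0 := hsupp g (by simpa using hg) k (by simpa using hk)
      (by
        rw [hug, hvk]
        intro a b ha hb _
        exact ⟨Finset.mem_singleton.1 (Finsupp.support_single_subset ha),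
          Finset.mem_singleton.1 (Finsupp.support_single_subset hb)⟩)
    rw [hue, hve, AddMonoidAlgebra.single_mul_single, h0, AddMonoidAlgebra.one_def] at huv
    have := congrArg (fun f => AddMonoidAlgebra.coeff f 0) huv
    simpa using this
  exact ⟨g, Units.mkOfMulEqOne _ _ hgk, hue⟩

theorem LaurentTS.exists_eq_smul_of_span_eq {G P : LaurentTS}
    (h : Ideal.span {G} = Ideal.span {P}) :
    ∃ (e : ℤˣ) (k l : ℤ), G = (e : ℤ) • (monoTS k l * P) := by
  obtain ⟨u, hu⟩ := (Ideal.span_singleton_eq_span_singleton.1 h).symm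
  obtain ⟨⟨k, l⟩, e, hue⟩ := AddMonoidAlgebra.exists_eq_single_of_isUnit u.isUnit
  refine ⟨e, k, l, ?_⟩
  rw [← hu, hue, monoTS, mul_comm P, ← smul_mul_assoc, AddMonoidAlgebra.smul_single, smul_eq_mul,
    mul_one]

instance : Fintype Side :=
  ⟨⟨[Side.left, Side.right], by simp⟩, fun i => by cases i <;> simp⟩

theorem Side.sum_univ {M : Type*} [AddCommMonoid M] (f : Side → M) :
    ∑ i, f i = f Side.left + f Side.right := by
  change (([Side.left, Side.right] : Multiset Side).map f).sum = _
  simp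

/-- A function that is constant along a relation, on the quotient by the equivalence generated. -/
def Relation.EqvGen.lift {α β : Type*} {r : α → α → Prop} (f : α → β)
    (hf : ∀ a b, r a b → f a = f b) : Quotient (EqvGen.setoid r) → β :=
  Quotient.lift f fun _ _ h => by
    induction h with
    | rel a b h => exact hf a b h
    | refl a => rfl
    | symm a b _ ih => exact ih.symm
    | trans a b c _ _ ih ih' => exact ih.trans ih'

/-! ### Planarity and Alexander numberings -/

namespace DiagramCode

variable {X : Type*} (D : DiagramCode X)

instance [Finite X] : Finite D.Face := Quotient.finite _

instance [Finite X] : Finite D.GraphComponent := Quotient.finite _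

/-- The face to the right of a half-edge which is directed away from its crossing. -/
def face (h : HalfEdge X) : D.Face := Quotient.mk _ h

/-- The connected component of a crossing. -/
def component (c : X) : D.GraphComponent := Quotient.mk _ c

theorem face_rotate_opposite (h : HalfEdge X) : D.face (rotate (D.opposite h)) = D.face h :=
  Eq.symm (Quotient.sound (EqvGen.rel h _ rfl))

/-- Each of the four sectors at a crossing lies between two half-edges; following one of these to
its far end gives a second name for the same face. -/
theorem face_bottom (c : X) :
    D.face (Sum.inr (c, Side.right)) = D.face (Sum.inl (D.next.symm (c, Side.left))) := by
  simpa [opposite, rotate] using D.face_rotate_opposite (Sum.inl (D.next.symm (c, Side.left)))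

theorem face_right (c : X) :
    D.face (Sum.inl (c, Side.right)) = D.face (Sum.inl (D.next.symm (c, Side.right))) := by
  simpa [opposite, rotate] using D.face_rotate_opposite (Sum.inl (D.next.symm (c, Side.right)))

theorem face_top (c : X) :
    D.face (Sum.inl (c, Side.left)) = D.face (Sum.inr (D.next (c, Side.right))) := by
  simpa [opposite, rotate] using D.face_rotate_opposite (Sum.inr (D.next (c, Side.right)))

theorem face_left (c : X) :
    D.face (Sum.inr (c, Side.left)) = D.face (Sum.inr (D.next (c, Side.left))) := by
  simpa [opposite, rotate] using D.face_rotate_opposite (Sum.inr (D.next (c, Side.left)))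

theorem component_next (h : X × Side) : D.component (D.next h).1 = D.component h.1 :=
  (Quotient.sound (EqvGen.rel _ _ ⟨h.2, rfl⟩)).symm

/-- The crossing at which a half-edge is attached. -/
def crossing : HalfEdge X → X
  | Sum.inl h => h.1
  | Sum.inr h => h.1

theorem crossing_rotate (h : HalfEdge X) : crossing (rotate h) = crossing h := by
  obtain ⟨c, _ | _⟩ | ⟨c, _ | _⟩ := h <;> rfl

theorem component_crossing_opposite (h : HalfEdge X) :
    D.component (crossing (D.opposite h)) = D.component (crossing h) := by
  obtain h | h := h
  · exact D.component_next h
  · simpa [opposite, crossing] using (D.component_next (D.next.symm h)).symm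

/-- The connected component of the boundary of a face. -/
def faceComponent : D.Face → D.GraphComponent :=
  EqvGen.lift (fun h => D.component (crossing h)) fun a b h => by
    rw [h, crossing_rotate, D.component_crossing_opposite]

/-- The difference of a function on faces across the edges, right minus left. -/
def faceDifference : (D.Face → ℚ) →ₗ[ℚ] (X × Side → ℚ) where
  toFun f h := f (D.face (Sum.inl h)) - f (D.face (Sum.inr (D.next h)))
  map_add' f g := by ext h; simp only [Pi.add_apply]; ring
  map_smul' a f := by ext h; simp only [Pi.smul_apply, smul_eq_mul, RingHom.id_apply]; ring

open Classical in
/-- The incidence matrix of the oriented graph. -/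
noncomputable def incidence : Matrix X (X × Side) ℚ := fun c h =>
  (if c = h.1 then 1 else 0) - if c = (D.next h).1 then 1 else 0

theorem incidence_mulVec [Fintype X] (g : X × Side → ℚ) (c : X) :
    (D.incidence.mulVec g) c = g (c, Side.left) + g (c, Side.right) -
      (g (D.next.symm (c, Side.left)) + g (D.next.symm (c, Side.right))) := by
  classical
  simp only [Matrix.mulVec, dotProduct, incidence, sub_mul, Finset.sum_sub_distrib]
  rw [← D.next.symm.sum_comp fun h => (if c = (D.next h).1 then (1 : ℚ) else 0) * g h]
  simp [Fintype.sum_prod_type, Side.sum_univ, Finset.sum_add_distrib]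

theorem incidence_transpose_mulVec [Fintype X] (f : X → ℚ) (h : X × Side) :
    (D.incidence.transpose.mulVec f) h = f h.1 - f (D.next h).1 := by
  classical
  simp [Matrix.mulVec, dotProduct, incidence, sub_mul, Finset.sum_sub_distrib]

/-- Around a crossing the face values telescope, each of the four sectors occurring twice with
opposite signs. -/
theorem incidence_mulVec_faceDifference [Fintype X] (f : D.Face → ℚ) :
    D.incidence.mulVec (D.faceDifference f) = 0 := by
  ext c
  rw [incidence_mulVec]
  simp only [faceDifference, LinearMap.coe_mk, AddHom.coe_mk, Equiv.apply_symm_apply,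
    D.face_bottom, D.face_top, D.face_left, D.face_right, Pi.zero_apply]
  ring

theorem finrank_ker_incidence_transpose [Fintype X] :
    Module.finrank ℚ (LinearMap.ker D.incidence.transpose.mulVecLin) ≤
      Nat.card D.GraphComponent := by
  classical
  have := Fintype.ofFinite D.GraphComponent
  have hle : LinearMap.ker D.incidence.transpose.mulVecLin ≤
      LinearMap.range (LinearMap.funLeft ℚ ℚ D.component) := by
    intro f hf
    rw [LinearMap.mem_ker, Matrix.mulVecLin_apply] at hf
    refine ⟨EqvGen.lift f ?_, rfl⟩
    rintro c _ ⟨i, rfl⟩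
    have := congrFun hf (c, i)
    rw [incidence_transpose_mulVec] at this
    exact sub_eq_zero.1 this
  refine (Submodule.finrank_mono hle).trans ((LinearMap.finrank_range_le _).trans ?_)
  rw [Module.finrank_fintype_fun_eq_card, Nat.card_eq_fintype_card]

/-- A function with equal values on both sides of every edge agrees on the four sectors of each
crossing, hence is constant on each connected component. -/
theorem finrank_ker_faceDifference [Finite X] :
    Module.finrank ℚ (LinearMap.ker D.faceDifference) ≤ Nat.card D.GraphComponent := by
  classical
  have := Fintype.ofFinite D.GraphComponent
  have := Fintype.ofFinite D.Face
  have hle : LinearMap.ker D.faceDifference ≤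
      LinearMap.range (LinearMap.funLeft ℚ ℚ D.faceComponent) := by
    intro f hf
    have hedge : ∀ h, f (D.face (Sum.inl h)) = f (D.face (Sum.inr (D.next h))) := fun h =>
      sub_eq_zero.1 (congrFun (LinearMap.mem_ker.1 hf) h)
    have hl : ∀ c, f (D.face (Sum.inl (c, Side.left))) = f (D.face (Sum.inr (c, Side.left))) :=
      fun c => by rw [hedge, D.face_left]
    have hr : ∀ c, f (D.face (Sum.inl (c, Side.right))) = f (D.face (Sum.inr (c, Side.left))) :=
      fun c => by rw [hedge, ← D.face_top, hl]
    have hb : ∀ c, f (D.face (Sum.inr (c, Side.right))) = f (D.face (Sum.inr (c, Side.left))) :=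
      fun c => by rw [← hr, D.face_right, hedge, Equiv.apply_symm_apply]
    have hat : ∀ h, f (D.face h) = f (D.face (Sum.inr (crossing h, Side.left))) := by
      rintro (⟨c, _ | _⟩ | ⟨c, _ | _⟩)
      exacts [hl c, hr c, rfl, hb c]
    refine ⟨EqvGen.lift (fun c => f (D.face (Sum.inr (c, Side.left)))) ?_, ?_⟩
    · rintro c _ ⟨i, rfl⟩
      exact ((hat (Sum.inl (c, i))).symm.trans (hedge (c, i))).trans (hat _)
    · ext F
      obtain ⟨h, rfl⟩ := Quotient.exists_rep F
      exact (hat h).symm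
  refine (Submodule.finrank_mono hle).trans ((LinearMap.finrank_range_le _).trans ?_)
  rw [Module.finrank_fintype_fun_eq_card, Nat.card_eq_fintype_card]

/-- On a planar diagram every circulation is the difference of a function on the faces. -/
theorem range_faceDifference [Fintype X] (hD : D.IsPlanar) :
    LinearMap.range D.faceDifference = LinearMap.ker D.incidence.mulVecLin := by
  classical
  have := Fintype.ofFinite D.Face
  apply Submodule.eq_of_le_of_finrank_le
  · rintro _ ⟨f, rfl⟩
    exact D.incidence_mulVec_faceDifference f
  -- With V, E, F, C the numbers of crossings, edges, faces and components: the kernel of the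
  -- incidence matrix has dimension at most E - V + C, the range of `faceDifference` at least F - C,
  -- and Euler's formula equates these bounds.
  · have h1 := LinearMap.finrank_range_add_finrank_ker D.faceDifference
    have h2 := LinearMap.finrank_range_add_finrank_ker D.incidence.mulVecLin
    have h3 := LinearMap.finrank_range_add_finrank_ker D.incidence.transpose.mulVecLin
    have h4 : Module.finrank ℚ (LinearMap.range D.incidence.transpose.mulVecLin) =
        Module.finrank ℚ (LinearMap.range D.incidence.mulVecLin) := D.incidence.rank_transpose
    have h5 := D.finrank_ker_incidence_transpose
    have h6 := D.finrank_ker_faceDifference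
    simp only [Module.finrank_fintype_fun_eq_card, ← Nat.card_eq_fintype_card] at h1 h2 h3
    unfold IsPlanar at hD
    omega

/-- An Alexander numbering of the edges: the integer belongs to the face on the left. -/
theorem exists_alexanderNumbering [Finite X] (hD : D.IsPlanar) :
    ∃ n : X × Side → ℤ, ∀ c, n (D.next.symm (c, Side.left)) = n (c, Side.left) ∧
      n (c, Side.right) = n (c, Side.left) + 1 ∧
      n (D.next.symm (c, Side.right)) = n (c, Side.left) + 1 := by
  have := Fintype.ofFinite X
  have hone : (fun _ => 1 : X × Side → ℚ) ∈ LinearMap.range D.faceDifference := by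
    rw [D.range_faceDifference hD, LinearMap.mem_ker, Matrix.mulVecLin_apply]
    ext c
    rw [incidence_mulVec]
    simp
  obtain ⟨f, hf⟩ := hone
  have hstep : ∀ h, f (D.face (Sum.inl h)) = f (D.face (Sum.inr (D.next h))) + 1 := fun h =>
    eq_add_of_sub_eq' (congrFun hf h)
  -- The dimension count only gives rational face values; the floor makes them integral and
  -- preserves steps of 1.
  refine ⟨fun h => ⌊f (D.face (Sum.inr (D.next h)))⌋, fun c => ⟨?_, ?_, ?_⟩⟩
  · simp only [Equiv.apply_symm_apply, D.face_left]
  · simp only [← D.face_top, ← D.face_left, hstep, Int.floor_add_one]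
  · simp only [Equiv.apply_symm_apply, D.face_bottom, hstep, Int.floor_add_one, D.face_left]

end DiagramCode

/-! ### The isomorphism between the two modules -/

theorem monoTS_mul (k l k' l' : ℤ) : monoTS k l * monoTS k' l' = monoTS (k + k') (l + l') := by
  simp [monoTS, AddMonoidAlgebra.single_mul_single]

theorem monoTS_zero : monoTS 0 0 = 1 := rfl

namespace VirtualLinkDiagram

variable {X : Type*} (D : VirtualLinkDiagram X)

/-- An integer labelling of the short arcs that takes equal values on the two left arcs at each
crossing and the next larger value on the two right arcs. -/
structure IsArcNumbering (n : D.ShortArc → ℤ) : Prop where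
  left_in (c : X) : n (D.inArc c Side.left) = n (D.outArc c Side.left)
  right_out (c : X) : n (D.outArc c Side.right) = n (D.outArc c Side.left) + 1
  right_in (c : X) : n (D.inArc c Side.right) = n (D.outArc c Side.left) + 1

theorem exists_isArcNumbering [Finite X] : ∃ n, D.IsArcNumbering n := by
  obtain ⟨n, hn⟩ := D.exists_alexanderNumbering D.planar
  -- Crossing-free circles meet no condition, so their label 0 is arbitrary.
  exact ⟨Sum.elim n 0, fun c => (hn c).1, fun c => (hn c).2.1, fun c => (hn c).2.2⟩

namespace IsArcNumbering

variable {D} {n : D.ShortArc → ℤ}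

theorem classical (hn : D.IsArcNumbering n) {uL uR oL oR : D.ShortArc}
    (h : D.IsClassicalCrossing uL uR oL oR) :
    n uR = n uL + 1 ∧ n oL = n uL ∧ n oR = n uL + 1 := by
  obtain c | c := h <;> simp [hn.left_in, hn.right_out, hn.right_in]

theorem virtual (hn : D.IsArcNumbering n) {l r : D.ShortArc} (h : D.IsVirtualStrand l r) :
    n r = n l + 1 := by
  obtain c | c := h <;> simp [hn.left_in, hn.right_out, hn.right_in]

end IsArcNumbering

/-- The class of a long arc in the Alexander biquandle module. -/
noncomputable def abqMk (a : D.ShortArc) : D.ABQ := Submodule.Quotient.mk (D.longGen a)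

/-- The class of a short arc in the virtual Alexander quandle module. -/
noncomputable def vaqMk (a : D.ShortArc) : D.VAQ := Submodule.Quotient.mk (D.shortGen a)

theorem abqMk_under {uL uR oL oR : D.ShortArc} (h : D.IsClassicalCrossing uL uR oL oR) :
    D.abqMk uR = (monoTS 0 (-1) * monoTS 1 0) • D.abqMk uL +
      (monoTS 0 (-1) * (1 - monoTS 1 0)) • D.abqMk oL :=
  (Submodule.Quotient.eq _).2 (Submodule.subset_span (ABQRel.under _ _ _ _ h))

theorem abqMk_over {uL uR oL oR : D.ShortArc} (h : D.IsClassicalCrossing uL uR oL oR) :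
    D.abqMk oR = monoTS 0 (-1) • D.abqMk oL :=
  (Submodule.Quotient.eq _).2 (Submodule.subset_span (ABQRel.over _ _ _ _ h))

theorem toLong_eq_of_isVirtualStrand {l r : D.ShortArc} (h : D.IsVirtualStrand l r) :
    D.toLong l = D.toLong r := by
  obtain ⟨c, hc⟩ | ⟨c, hc⟩ := h
  · exact Quotient.sound (EqvGen.rel _ _ (VirtualStep.leftToRight c hc))
  · exact (Quotient.sound (EqvGen.rel _ _ (VirtualStep.rightToLeft c hc))).symm

theorem vaqMk_under {uL uR oL oR : D.ShortArc} (h : D.IsClassicalCrossing uL uR oL oR) :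
    D.vaqMk uR = monoTS 1 0 • D.vaqMk uL + (1 - monoTS 1 0) • D.vaqMk oL :=
  (Submodule.Quotient.eq _).2 (Submodule.subset_span (VAQRel.under _ _ _ _ h))

theorem vaqMk_over {uL uR oL oR : D.ShortArc} (h : D.IsClassicalCrossing uL uR oL oR) :
    D.vaqMk oR = D.vaqMk oL :=
  (Submodule.Quotient.eq _).2 (Submodule.subset_span (VAQRel.over _ _ _ _ h))

theorem vaqMk_virtual {l r : D.ShortArc} (h : D.IsVirtualStrand l r) :
    D.vaqMk r = monoTS 0 1 • D.vaqMk l :=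
  (Submodule.Quotient.eq _).2 (Submodule.subset_span (VAQRel.virtual _ _ h))

variable {D} {n : D.ShortArc → ℤ}

/-- The homomorphism which sends a short arc `a` to `s ^ n a` times the long arc containing it. -/
noncomputable def vaqToABQ (hn : D.IsArcNumbering n) : D.VAQ →ₗ[LaurentTS] D.ABQ :=
  Submodule.liftQ _ (Finsupp.linearCombination LaurentTS fun a => monoTS 0 (n a) • D.abqMk a) <| by
    rw [Submodule.span_le]
    rintro _ (⟨uL, uR, oL, oR, h⟩ | ⟨uL, uR, oL, oR, h⟩ | ⟨l, r, h⟩)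
    · obtain ⟨h1, h2, h3⟩ := hn.classical h
      rw [SetLike.mem_coe, LinearMap.mem_ker]
      simp only [map_sub, map_add, map_smul, shortGen, Finsupp.linearCombination_single,
        D.abqMk_under h, h1, h2, smul_add, smul_smul]
      -- The label of `uR` exceeds that of `uL` by one, which cancels the `s⁻¹` of the biquandle
      -- relation.
      have : monoTS 0 (n uL + 1) * monoTS 0 (-1) = monoTS 0 (n uL) := by simp [monoTS_mul]
      simp only [← mul_assoc, this]
      module
    · obtain ⟨h1, h2, h3⟩ := hn.classical h
      rw [SetLike.mem_coe, LinearMap.mem_ker]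
      simp [shortGen, D.abqMk_over h, h2, h3, smul_smul, monoTS_mul]
    · rw [SetLike.mem_coe, LinearMap.mem_ker]
      simp [shortGen, hn.virtual h, smul_smul, monoTS_mul, abqMk, longGen,
        D.toLong_eq_of_isVirtualStrand h, add_comm]

theorem vaqToABQ_vaqMk (hn : D.IsArcNumbering n) (a : D.ShortArc) :
    vaqToABQ hn (D.vaqMk a) = monoTS 0 (n a) • D.abqMk a := by
  simp [vaqToABQ, vaqMk, shortGen]

/-- The element `s ^ (-n a) • a` only depends on the long arc containing the short arc `a`. -/
noncomputable def longToVAQ (hn : D.IsArcNumbering n) : D.LongArc → D.VAQ :=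
  EqvGen.lift (fun a => monoTS 0 (-n a) • D.vaqMk a) <| by
    have key : ∀ {l r}, D.IsVirtualStrand l r →
        monoTS 0 (-n l) • D.vaqMk l = monoTS 0 (-n r) • D.vaqMk r := fun {l r} h => by
      simp [D.vaqMk_virtual h, hn.virtual h, smul_smul, monoTS_mul]
    rintro _ _ (⟨c, hc⟩ | ⟨c, hc⟩)
    · exact key (IsVirtualStrand.leftToRight c hc)
    · exact (key (IsVirtualStrand.rightToLeft c hc)).symm

theorem longToVAQ_toLong (hn : D.IsArcNumbering n) (a : D.ShortArc) :
    longToVAQ hn (D.toLong a) = monoTS 0 (-n a) • D.vaqMk a := rfl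

/-- The homomorphism which sends the long arc through `a` to `s ^ (-n a)` times `a`. -/
noncomputable def abqToVAQ (hn : D.IsArcNumbering n) : D.ABQ →ₗ[LaurentTS] D.VAQ :=
  Submodule.liftQ _ (Finsupp.linearCombination LaurentTS (longToVAQ hn)) <| by
    rw [Submodule.span_le]
    rintro _ (⟨uL, uR, oL, oR, h⟩ | ⟨uL, uR, oL, oR, h⟩)
    · obtain ⟨h1, h2, h3⟩ := hn.classical h
      rw [SetLike.mem_coe, LinearMap.mem_ker]
      simp only [map_sub, map_add, map_smul, longGen, Finsupp.linearCombination_single,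
        longToVAQ_toLong, D.vaqMk_under h, h1, h2, smul_add, smul_smul]
      have : monoTS 0 (-(n uL + 1)) = monoTS 0 (-1) * monoTS 0 (-n uL) := by
        simp [monoTS_mul]
      rw [this]
      module
    · obtain ⟨h1, h2, h3⟩ := hn.classical h
      rw [SetLike.mem_coe, LinearMap.mem_ker]
      simp [longGen, longToVAQ_toLong, D.vaqMk_over h, h2, h3, smul_smul, monoTS_mul]

theorem abqToVAQ_abqMk (hn : D.IsArcNumbering n) (a : D.ShortArc) :
    abqToVAQ hn (D.abqMk a) = monoTS 0 (-n a) • D.vaqMk a := by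
  rw [← longToVAQ_toLong hn]
  simp [abqToVAQ, abqMk, longGen]

/-- The modules of the Alexander biquandle and of the virtual Alexander quandle are isomorphic. -/
noncomputable def abqEquivVAQ (hn : D.IsArcNumbering n) : D.ABQ ≃ₗ[LaurentTS] D.VAQ :=
  LinearEquiv.ofLinearMap (abqToVAQ hn) (vaqToABQ hn)
    (by
      refine Submodule.linearMap_qext _ (Finsupp.lhom_ext' fun a => LinearMap.ext_ring ?_)
      change abqToVAQ hn (vaqToABQ hn (D.vaqMk a)) = D.vaqMk a
      simp [vaqToABQ_vaqMk, abqToVAQ_abqMk, smul_smul, monoTS_mul, monoTS_zero])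
    (by
      refine Submodule.linearMap_qext _ (Finsupp.lhom_ext' fun b => LinearMap.ext_ring ?_)
      obtain ⟨a, rfl⟩ := Quotient.exists_rep b
      change vaqToABQ hn (abqToVAQ hn (D.abqMk a)) = D.abqMk a
      simp [vaqToABQ_vaqMk, abqToVAQ_abqMk, smul_smul, monoTS_mul, monoTS_zero])

/-! ### A square presentation of the quandle module -/

variable (D)

/-- The defining relations of the virtual Alexander quandle module as a square system: two for each
crossing, and a zero relation for each component without crossings. -/
noncomputable def vaqRelation : D.ShortArc → D.ShortFree
  | Sum.inl (c, i) =>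
    match D.kind c, i with
    | CrossingKind.positive, Side.left => D.shortGen (D.inArc c Side.right) -
        (monoTS 1 0 • D.shortGen (D.outArc c Side.left) +
          (1 - monoTS 1 0) • D.shortGen (D.inArc c Side.left))
    | CrossingKind.positive, Side.right =>
        D.shortGen (D.outArc c Side.right) - D.shortGen (D.inArc c Side.left)
    | CrossingKind.negative, Side.left => D.shortGen (D.outArc c Side.right) -
        (monoTS 1 0 • D.shortGen (D.inArc c Side.left) +
          (1 - monoTS 1 0) • D.shortGen (D.outArc c Side.left))
    | CrossingKind.negative, Side.right =>
        D.shortGen (D.inArc c Side.right) - D.shortGen (D.outArc c Side.left)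
    | CrossingKind.virtual, Side.left =>
        D.shortGen (D.outArc c Side.right) - monoTS 0 1 • D.shortGen (D.inArc c Side.left)
    | CrossingKind.virtual, Side.right =>
        D.shortGen (D.inArc c Side.right) - monoTS 0 1 • D.shortGen (D.outArc c Side.left)
  -- A crossing-free circle is a free generator; the zero row keeps the system square and makes the
  -- determinant vanish.
  | Sum.inr _ => 0

theorem span_range_vaqRelation :
    Submodule.span LaurentTS (Set.range D.vaqRelation) =
      Submodule.span LaurentTS {r | D.VAQRel r} := by
  apply le_antisymm <;> rw [Submodule.span_le]
  · rintro _ ⟨⟨c, i⟩ | k, rfl⟩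
    · apply Submodule.subset_span
      cases hc : D.kind c <;> cases i <;> simp only [vaqRelation, hc, Set.mem_ofPred_eq]
      · exact VAQRel.under _ _ _ _ (IsClassicalCrossing.positive c hc)
      · exact VAQRel.over _ _ _ _ (IsClassicalCrossing.positive c hc)
      · exact VAQRel.under _ _ _ _ (IsClassicalCrossing.negative c hc)
      · exact VAQRel.over _ _ _ _ (IsClassicalCrossing.negative c hc)
      · exact VAQRel.virtual _ _ (IsVirtualStrand.leftToRight c hc)
      · exact VAQRel.virtual _ _ (IsVirtualStrand.rightToLeft c hc)
    · exact Submodule.zero_mem _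
  · rintro _ (⟨_, _, _, _, ⟨c, hc⟩ | ⟨c, hc⟩⟩ | ⟨_, _, _, _, ⟨c, hc⟩ | ⟨c, hc⟩⟩ |
      ⟨_, _, ⟨c, hc⟩ | ⟨c, hc⟩⟩)
    · exact Submodule.subset_span ⟨Sum.inl (c, Side.left), by simp only [vaqRelation, hc]⟩
    · exact Submodule.subset_span ⟨Sum.inl (c, Side.left), by simp only [vaqRelation, hc]⟩
    · exact Submodule.subset_span ⟨Sum.inl (c, Side.right), by simp only [vaqRelation, hc]⟩
    · exact Submodule.subset_span ⟨Sum.inl (c, Side.right), by simp only [vaqRelation, hc]⟩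
    · exact Submodule.subset_span ⟨Sum.inl (c, Side.left), by simp only [vaqRelation, hc]⟩
    · exact Submodule.subset_span ⟨Sum.inl (c, Side.right), by simp only [vaqRelation, hc]⟩

theorem exists_isXiPolynomial [Finite X] : ∃ P, D.IsXiPolynomial P := by
  classical
  have := Fintype.ofFinite X
  refine ⟨_, (fittingIdeal_congr (Submodule.quotEquivOfEq _ _ ?_)).trans
    (fittingIdeal_quotient_span_range D.vaqRelation)⟩
  exact D.span_range_vaqRelation.symm

end VirtualLinkDiagram

theorem mainTheorem5 {X : Type*} [Finite X] (D : VirtualLinkDiagram X) :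
    Nonempty (D.ABQ ≃ₗ[LaurentTS] D.VAQ) ∧
    (∃ G : LaurentTS, D.IsGeneralizedAlexanderPolynomial G) ∧
    (∃ P : LaurentTS, D.IsXiPolynomial P) ∧
    (∀ G P : LaurentTS, D.IsGeneralizedAlexanderPolynomial G → D.IsXiPolynomial P →
      ∃ (e : ℤˣ) (k l : ℤ), G = (e : ℤ) • (monoTS k l * P)) := by
  obtain ⟨n, hn⟩ := D.exists_isArcNumbering
  have hfit := fittingIdeal_congr (VirtualLinkDiagram.abqEquivVAQ hn)
  obtain ⟨P, hP⟩ := D.exists_isXiPolynomial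
  exact ⟨⟨VirtualLinkDiagram.abqEquivVAQ hn⟩, ⟨P, hfit.trans hP⟩, ⟨P, hP⟩, fun G Q hG hQ =>
    LaurentTS.exists_eq_smul_of_span_eq (hG.symm.trans (hfit.trans hQ))⟩
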